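/- Let $0<T_c<T_h$ (units with $k_B=1$). For $N$ spins one half on a ring consider the Ising Hamiltonian $H_N(J,h)=-h\sum_{j=1}^N\sigma_z^{(j)}-J\sum_{j=1}^N\sigma_z^{(j)}\sigma_z^{(j+1)}$ with $\sigma_z^{(N+1)}=\sigma_z^{(1)}$, and for fields $h_A,h_B,h_C,h_D$ let $\omega_T^X=e^{-H_N(J,h_X)/T}/\operatorname{Tr}e^{-H_N(J,h_X)/T}$. With the von Neumann entropy $S$, the relative entropy $D$ and $\Delta S=S(\omega_{T_h}^B)-S(\omega_{T_c}^D)$ put $$W_N=(T_h-T_c)\,\Delta S-T_hD(\omega_{T_c}^D\|\omega_{T_h}^A)-T_cD(\omega_{T_h}^B\|\omega_{T_c}^C),\qquad \eta_N=1-\frac{T_c}{T_h}\,\frac{\Delta S+D(\omega_{T_h}^B\|\omega_{T_c}^C)}{\Delta S-D(\omega_{T_c}^D\|\omega_{T_h}^A)} .$$ These are the work and the efficiency of a Carnot-like cycle: for all $N$, $J$ and all fields, consider the cycle consisting of a sudden change of the field $h_D\to h_A$ starting in $\omega_{T_c}^D$, a contact with the hot bath, an $m$-step path $h_A\to h_B$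 (equal sudden field changes, each followed by a contact with the hot bath), a sudden change $h_B\to h_C$, a contact with the cold bath, and an $m$-step path $h_C\to h_D$ with contacts with the cold bath; a contact replaces the state by the Gibbs state of the current Hamiltonian. As $m\to\infty$ its total work (the sum of the energy decreases in the sudden changes) tends to $W_N$, and, if $\Delta S>D(\omega_{T_c}^D\|\omega_{T_h}^A)$, its total work divided by the absolute value of the heat delivered by the hot bath tends to $\eta_N$. Now let $J<0$, $h_B=h_C=2J$ (or $h_B=h_C=2|J|$; each of the two choices is allowed) and $h_A=h_D=x$. 1. The ground-state space of $H_N(J,h_B)$ has dimension at least $2^{\lfloor N/2\rfloor}$, for every $N$. 2. The limits $w(J,x)=\lim_{N\to\infty}W_N/N$, for all $x$, and $s(J)=\lim_{N\to\infty}S(\omega_{T_h}^B)/N$ exist. For all sufficiently large $x$ (depending on $J$), $\Delta S>D(\omega_{T_c}^D\|\omega_{T_h}^A)$ for all large $N$ and $\eta(J,x)=\lim_{N\to\infty}\eta_N$ exists. 3. The limits $w(J)=\lim_{x\to\infty}w(J,x)$ and $\eta(J)=\lim_{x\to\infty}\eta(J,x)$ exist, and $$\lim_{J\to-\infty}\eta(J)=1-\frac{T_c}{T_h},\qquad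 \lim_{J\to-\infty}w(J)=(T_h-T_c)\lim_{J\to-\infty}s(J)\ \ge\ (T_h-T_c)\,\tfrac12\log 2,$$ where the limits of $w(J)$ and $s(J)$ exist and are finite. 4. The same holds if the field $x=x(J)$ is chosen as any function of $J$ with $x(J)/|J|\to\infty$ as $J\to-\infty$: for all sufficiently negative $J$, $\Delta S>D(\omega_{T_c}^D\|\omega_{T_h}^A)$ for all large $N$ and $\eta(J,x(J))=\lim_{N\to\infty}\eta_N$ exists; moreover $\eta(J,x(J))\to1-T_c/T_h$, and $w(J,x(J))$ has the same limit as $w(J)$ in part 3. -/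

import Mathlib

open Filter Topology

namespace IsingEngine

noncomputable section

/-- Operators on the Hilbert space of `N` spins one half, as matrices in the product basis
labelled by `Fin N → Fin 2` (`0` is spin up, `1` is spin down). -/
abbrev Op (N : ℕ) : Type := Matrix (Fin N → Fin 2) (Fin N → Fin 2) ℂ

/-- The Pauli matrix `σ_z`. -/
def pauliZ : Matrix (Fin 2) (Fin 2) ℂ := !![1, 0; 0, -1]

/-- `1 ⊗ ⋯ ⊗ A ⊗ ⋯ ⊗ 1`, with `A` acting on the spin at site `j`. -/
def onSite {N : ℕ} (j : Fin N) (A : Matrix (Fin 2) (Fin 2) ℂ) : Op N :=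
  fun s t => if ∀ k, k ≠ j → s k = t k then A (s j) (t j) else 0

/-- The Ising Hamiltonian `-h ∑ⱼ σ_z^{(j)} - J ∑ⱼ σ_z^{(j)} σ_z^{(j+1)}` on a ring of `N` spins;
`finRotate N` sends site `j` to site `j + 1`, and the last site to the first. -/
def hamiltonian (N : ℕ) (J h : ℝ) : Op N :=
  -((h : ℂ) • ∑ j : Fin N, onSite j pauliZ)
    - (J : ℂ) • ∑ j : Fin N, onSite j pauliZ * onSite (finRotate N j) pauliZ

/-- The Gibbs state `exp (-H / T) / Tr exp (-H / T)` at temperature `T` (with `k_B = 1`). -/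
def gibbs {N : ℕ} (T : ℝ) (H : Op N) : Op N :=
  (Matrix.trace (NormedSpace.exp (-((T⁻¹ : ℝ) : ℂ) • H)))⁻¹ •
    NormedSpace.exp (-((T⁻¹ : ℝ) : ℂ) • H)

/-- The mean energy `Tr (ρ H)`. -/
def energy {N : ℕ} (ρ H : Op N) : ℝ := (Matrix.trace (ρ * H)).re

/-- The von Neumann entropy `S(ρ) = -Tr (ρ log ρ)`. -/
def entropy {N : ℕ} (ρ : Op N) : ℝ := -(Matrix.trace (ρ * cfc Real.log ρ)).re

/-- The relative entropy `D(ρ‖σ) = Tr (ρ (log ρ - log σ))`, for a state `σ` of full rank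
(it is used for Gibbs states only). -/
def relEntropy {N : ℕ} (ρ σ : Op N) : ℝ :=
  (Matrix.trace (ρ * (cfc Real.log ρ - cfc Real.log σ))).re

/-- The Gibbs state of the Ising ring at temperature `T`, coupling `J` and field `h`. -/
def thermal (N : ℕ) (J T h : ℝ) : Op N := gibbs T (hamiltonian N J h)

/-- `ΔS^{B,D} = S(ω_h^B) - S(ω_c^D)`. -/
def deltaS (N : ℕ) (J Tc Th hB hD : ℝ) : ℝ :=
  entropy (thermal N J Th hB) - entropy (thermal N J Tc hD)

/-- The correction `D(ω_c^D‖ω_h^A)`. -/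
def penaltyDA (N : ℕ) (J Tc Th hD hA : ℝ) : ℝ :=
  relEntropy (thermal N J Tc hD) (thermal N J Th hA)

/-- The correction `D(ω_h^B‖ω_c^C)`. -/
def penaltyBC (N : ℕ) (J Tc Th hB hC : ℝ) : ℝ :=
  relEntropy (thermal N J Th hB) (thermal N J Tc hC)

/-- The work extracted per cycle of the Carnot-like protocol with fields `hA, hB, hC, hD`. -/
def work (N : ℕ) (J Tc Th hA hB hC hD : ℝ) : ℝ :=
  (Th - Tc) * deltaS N J Tc Th hB hD
    - (Th * penaltyDA N J Tc Th hD hA + Tc * penaltyBC N J Tc Th hB hC)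

/-- The efficiency of the Carnot-like protocol with fields `hA, hB, hC, hD`. -/
def efficiency (N : ℕ) (J Tc Th hA hB hC hD : ℝ) : ℝ :=
  1 - Tc / Th *
    ((deltaS N J Tc Th hB hD + penaltyBC N J Tc Th hB hC) /
      (deltaS N J Tc Th hB hD - penaltyDA N J Tc Th hD hA))

/-! ### The cycle itself, from sudden field changes and thermal contacts -/

/-- Work extracted when the field is changed suddenly from `h` to `h'` in the state `ρ`. -/
def quenchWork (N : ℕ) (J : ℝ) (ρ : Op N) (h h' : ℝ) : ℝ :=
  energy ρ (hamiltonian N J h) - energy ρ (hamiltonian N J h')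

/-- Heat delivered by a bath at temperature `T` when it takes the state `ρ` at field `h`
to the Gibbs state. -/
def contactHeat (N : ℕ) (J T : ℝ) (ρ : Op N) (h : ℝ) : ℝ :=
  energy (thermal N J T h) (hamiltonian N J h) - energy ρ (hamiltonian N J h)

/-- The `i`-th of the fields `a = g₀, …, g_m = b` of a path from `a` to `b` in `m` equal steps. -/
def pathField (a b : ℝ) (m i : ℕ) : ℝ := a + (b - a) * ((i : ℝ) / (m : ℝ))

/-- Work extracted along the `m`-step path from `a` to `b` at temperature `T`: each step is a
sudden change of the field followed by a thermal contact. -/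
def pathWork (N : ℕ) (J T a b : ℝ) (m : ℕ) : ℝ :=
  ∑ i ∈ Finset.range m,
    quenchWork N J (thermal N J T (pathField a b m i)) (pathField a b m i) (pathField a b m (i + 1))

/-- Heat delivered by the bath along the same path. -/
def pathHeat (N : ℕ) (J T a b : ℝ) (m : ℕ) : ℝ :=
  ∑ i ∈ Finset.range m,
    contactHeat N J T (thermal N J T (pathField a b m i)) (pathField a b m (i + 1))

/-- Total work of the cycle: sudden change `D → A`, contact with the hot bath, `m`-step path
`A → B` at `Th`, sudden change `B → C`, contact with the cold bath, `m`-step path `C → D`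
at `Tc`. -/
def cycleWork (N : ℕ) (J Tc Th hA hB hC hD : ℝ) (m : ℕ) : ℝ :=
  quenchWork N J (thermal N J Tc hD) hD hA + pathWork N J Th hA hB m
    + quenchWork N J (thermal N J Th hB) hB hC + pathWork N J Tc hC hD m

/-- Total heat delivered by the hot bath during that cycle. -/
def cycleHeat (N : ℕ) (J Tc Th hA hB : ℝ) (hD : ℝ) (m : ℕ) : ℝ :=
  contactHeat N J Th (thermal N J Tc hD) hA + pathHeat N J Th hA hB m

/-- `E` is the lowest eigenvalue of `H`. -/
def IsGroundEnergy {N : ℕ} (H : Op N) (E : ℝ) : Prop :=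
  IsLeast {x : ℝ | Module.End.HasEigenvalue (Matrix.toLin' H) (x : ℂ)} E

/-- The dimension of the eigenspace of `H` at the energy `E`. -/
def degeneracy {N : ℕ} (H : Op N) (E : ℝ) : ℕ :=
  Module.finrank ℂ (Module.End.eigenspace (Matrix.toLin' H) (E : ℂ))

end

end IsingEngine

/-!
The Hamiltonian is diagonal in the product basis, so every quantity is one of a classical Gibbs
ensemble with energies `E`: entropies and relative entropies are combinations of
`log Z = log ∑ exp (-β E)` and of mean energies (`entropy_thermal`, `relEntropy_thermal`). The
only inequality needed is the nonnegativity of the relative entropy of two Gibbs states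
(`gibbs_inequality`), which says that `log Z` lies above its tangents.

Cycle. The work of a path of `m` field changes is a Riemann sum of the mean magnetization, the
slope of `T log Z` as a function of the field. By the tangent inequality its distance to the
increment of `T log Z` is at most one step length times the increase of the magnetization, so it
vanishes as `m → ∞` (`tendsto_pathWork`).

Degeneracy. At the field `2 ε J`, `ε = ± 1`, the energy is a constant plus
`|J| ∑ⱼ (1 + ε zⱼ) (1 + ε zⱼ₊₁)`: the ground states have no two adjacent spins equal to `ε`, and
the spins on every second site may be chosen freely.

Thermodynamic limit. The transfer matrix gives `Z = λ₊ᴺ + λ₋ᴺ` (`partitionSum_ising`), hence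
`log Z / N → log λ₊` and the mean energy per site tends to `-∂ log λ₊ / ∂β`. This derivative is
never computed: if `log λ₊ - β c → K` for every `β > 0` in some asymptotic regime, then the tangent
inequality at `2 β` and `β / 2` shows that the energy per site is `-c + o(1)`, that the entropy per
site tends to `K`, and that relative entropies per site between two temperatures tend to `0`
(`tendsto_energyDensity_add`, `tendsto_entropyDensity`, `tendsto_relEntropyDensity`). In a strong
field `c = J + x` and `K = 0`, as soon as `x → ∞` and `x + 2 J → ∞`; this covers both `x → ∞` at
fixed `J` and `x / |J| → ∞`. At the field `± 2 J` with `J → -∞`, `c = -J` and `K` is the logarithm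
of the golden ratio, the growth rate of the number of ground states. Thus the work per site tends to
`(Th - Tc) log φ`, the penalties vanish, the efficiency tends to that of Carnot, and
`log φ ≥ (log 2) / 2` because `φ ^ 2 = φ + 1 ≥ 2`.
-/

namespace IsingEngine

/-! ### Finite classical Gibbs ensembles -/

section Ensemble

variable {ι : Type*} [Fintype ι]

/-- The partition function `∑ᵢ exp (-β Eᵢ)` of a finite system with energies `E`. -/
noncomputable def partitionSum (E : ι → ℝ) (β : ℝ) : ℝ := ∑ i, Real.exp (-β * E i)

/-- The Gibbs weight of the configuration `i` at inverse temperature `β`. -/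
noncomputable def gibbsWeight (E : ι → ℝ) (β : ℝ) (i : ι) : ℝ :=
  Real.exp (-β * E i) / partitionSum E β

/-- The Gibbs mean of the observable `f` at inverse temperature `β`. -/
noncomputable def gibbsMean (E : ι → ℝ) (β : ℝ) (f : ι → ℝ) : ℝ :=
  ∑ i, gibbsWeight E β i * f i

theorem gibbsMean_sub (E : ι → ℝ) (β : ℝ) (f g : ι → ℝ) :
    gibbsMean E β (fun i => f i - g i) = gibbsMean E β f - gibbsMean E β g := by
  simp [gibbsMean, mul_sub, Finset.sum_sub_distrib]

theorem gibbsMean_const_mul (E : ι → ℝ) (β c : ℝ) (f : ι → ℝ) :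
    gibbsMean E β (fun i => c * f i) = c * gibbsMean E β f := by
  simp [gibbsMean, Finset.mul_sum, mul_left_comm]

theorem hasDerivAt_partitionSum (E : ι → ℝ) (β : ℝ) :
    HasDerivAt (partitionSum E) (∑ i, Real.exp (-β * E i) * -E i) β := by
  unfold partitionSum
  refine HasDerivAt.fun_sum fun i _ => ?_
  have h : HasDerivAt (fun b : ℝ => -b * E i) (-E i) β := by
    simpa using ((hasDerivAt_id β).neg.mul_const (E i))
  exact h.exp

theorem gibbsMean_energy (E : ι → ℝ) (β : ℝ) {Z' : ℝ} (h : HasDerivAt (partitionSum E) Z' β) :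
    gibbsMean E β E = -(Z' / partitionSum E β) := by
  rw [h.unique (hasDerivAt_partitionSum E β), gibbsMean, Finset.sum_div, ← Finset.sum_neg_distrib]
  refine Finset.sum_congr rfl fun i _ => ?_
  rw [gibbsWeight]
  ring

variable [Nonempty ι]

theorem partitionSum_pos (E : ι → ℝ) (β : ℝ) : 0 < partitionSum E β :=
  Finset.sum_pos (fun _ _ => Real.exp_pos _) Finset.univ_nonempty

theorem gibbsWeight_pos (E : ι → ℝ) (β : ℝ) (i : ι) : 0 < gibbsWeight E β i :=
  div_pos (Real.exp_pos _) (partitionSum_pos E β)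

theorem sum_gibbsWeight (E : ι → ℝ) (β : ℝ) : ∑ i, gibbsWeight E β i = 1 := by
  simp only [gibbsWeight, ← Finset.sum_div]
  exact div_self (partitionSum_pos E β).ne'

theorem log_gibbsWeight (E : ι → ℝ) (β : ℝ) (i : ι) :
    Real.log (gibbsWeight E β i) = -β * E i - Real.log (partitionSum E β) := by
  rw [gibbsWeight, Real.log_div (Real.exp_ne_zero _) (partitionSum_pos E β).ne', Real.log_exp]

theorem gibbsMean_const (E : ι → ℝ) (β c : ℝ) : gibbsMean E β (fun _ => c) = c := by
  rw [gibbsMean, ← Finset.sum_mul, sum_gibbsWeight, one_mul]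

theorem le_gibbsMean (E : ι → ℝ) (β : ℝ) {f : ι → ℝ} {c : ℝ} (h : ∀ i, c ≤ f i) :
    c ≤ gibbsMean E β f := by
  rw [← gibbsMean_const E β c]
  exact Finset.sum_le_sum fun i _ => mul_le_mul_of_nonneg_left (h i) (gibbsWeight_pos E β i).le

/-- The Gibbs variational inequality, i.e. nonnegativity of the relative entropy of two Gibbs
states: the logarithm of the partition function lies above its tangents. -/
theorem gibbs_inequality (E E' : ι → ℝ) (β β' : ℝ) :
    Real.log (partitionSum E β) + gibbsMean E β (fun i => β * E i - β' * E' i)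
      ≤ Real.log (partitionSum E' β') := by
  have hZ := partitionSum_pos E β
  rw [Real.le_log_iff_exp_le (partitionSum_pos E' β'), Real.exp_add, Real.exp_log hZ]
  have h := convexOn_exp.map_sum_le (t := Finset.univ) (w := gibbsWeight E β)
    (p := fun i => β * E i - β' * E' i) (fun i _ => (gibbsWeight_pos E β i).le)
    (sum_gibbsWeight E β) (fun _ _ => Set.mem_univ _)
  simp only [smul_eq_mul] at h
  calc _ ≤ partitionSum E β * ∑ i, gibbsWeight E β i * Real.exp (β * E i - β' * E' i) :=
        mul_le_mul_of_nonneg_left h hZ.le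
    _ = _ := by
        rw [Finset.mul_sum, partitionSum]
        refine Finset.sum_congr rfl fun i _ => ?_
        rw [gibbsWeight, ← mul_assoc, ← partitionSum, mul_div_cancel₀ _ hZ.ne', ← Real.exp_add]
        ring_nf

end Ensemble

/-! ### Reduction to diagonal matrices -/

/-- The functional calculus of a real diagonal matrix acts entrywise: on the finite spectrum
every function is a polynomial. -/
theorem cfc_diagonal {N : ℕ} (f : ℝ → ℝ) (d : (Fin N → Fin 2) → ℝ) :
    cfc f (Matrix.diagonal (fun s => (d s : ℂ)) : Op N)
      = Matrix.diagonal (fun s => (f (d s) : ℂ)) := by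
  set a : Op N := Matrix.diagonal (fun s => (d s : ℂ)) with ha
  have hsa : IsSelfAdjoint a := by
    rw [IsSelfAdjoint, ha, Matrix.star_eq_conjTranspose, Matrix.diagonal_conjTranspose]
    congr 1
    ext s
    simp
  have hspec : spectrum ℝ a ⊆ Set.range d := by
    intro x hx
    have hx' : (algebraMap ℝ ℂ x) ∈ spectrum ℂ a := spectrum.algebraMap_mem ℂ hx
    rw [ha, spectrum_diagonal] at hx'
    obtain ⟨s, hs⟩ := hx'
    exact ⟨s, by simpa using hs⟩
  set q : Polynomial ℝ := Lagrange.interpolate (Finset.univ.image d) id f with hq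
  have hqd : ∀ s, q.eval (d s) = f (d s) := fun s =>
    Lagrange.eval_interpolate_at_node (v := id) f (Set.injOn_id _)
      (Finset.mem_image_of_mem d (Finset.mem_univ s))
  have hcongr : cfc f a = cfc (fun x => q.eval x) a := by
    refine cfc_congr fun x hx => ?_
    obtain ⟨s, rfl⟩ := hspec hx
    exact (hqd s).symm
  rw [hcongr, cfc_polynomial q a hsa]
  have h1 : a = Matrix.diagonalAlgHom ℝ (fun s => (d s : ℂ)) := rfl
  rw [h1, Polynomial.aeval_algHom_apply, Matrix.diagonalAlgHom_apply]
  congr 1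
  ext s
  rw [← hqd s]
  have h2 : (Polynomial.aeval (fun s => (d s : ℂ)) q) s = Polynomial.aeval (d s : ℂ) q :=
    (Polynomial.aeval_algHom_apply (Pi.evalAlgHom ℝ (fun _ : Fin N → Fin 2 => ℂ) s) _ q).symm
  rw [h2]
  exact Polynomial.aeval_algebraMap_apply_eq_algebraMap_eval (A := ℂ) (d s) q

/-- The eigenvalue of `σ_z` on the basis vector labelled `a`. -/
def spin (a : Fin 2) : ℝ := if a = 0 then 1 else -1

theorem pauliZ_eq : pauliZ = Matrix.diagonal (fun a => (spin a : ℂ)) := by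
  ext a b
  fin_cases a <;> fin_cases b <;> simp [pauliZ, spin]

theorem onSite_diagonal {N : ℕ} (j : Fin N) (d : Fin 2 → ℂ) :
    onSite j (Matrix.diagonal d) = Matrix.diagonal (fun s => d (s j)) := by
  ext s t
  rw [onSite, Matrix.diagonal_apply, Matrix.diagonal_apply]
  by_cases h : s = t
  · subst h
    simp
  · rw [if_neg h]
    split_ifs with h1 h2
    · exact absurd (funext fun k => if hk : k = j then hk ▸ h2 else h1 k hk) h
    · rfl
    · rfl

/-- The magnetization `∑ⱼ zⱼ` of a spin configuration. -/
noncomputable def magnetization {N : ℕ} (s : Fin N → Fin 2) : ℝ := ∑ j, spin (s j)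

/-- The bond sum `∑ⱼ zⱼ zⱼ₊₁` around the ring. -/
noncomputable def bondSum {N : ℕ} (s : Fin N → Fin 2) : ℝ :=
  ∑ j, spin (s j) * spin (s (finRotate N j))

/-- The classical Ising energy of a configuration, the diagonal entry of the Hamiltonian. -/
noncomputable def isingEnergy (N : ℕ) (J h : ℝ) (s : Fin N → Fin 2) : ℝ :=
  -(h * magnetization s) - J * bondSum s

theorem hamiltonian_eq (N : ℕ) (J h : ℝ) :
    hamiltonian N J h = Matrix.diagonal (fun s => (isingEnergy N J h s : ℂ)) := by
  have hsum : ∀ f : Fin N → (Fin N → Fin 2) → ℂ,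
      ∑ j, Matrix.diagonal (f j) = Matrix.diagonal (fun s => ∑ j, f j s) := by
    intro f
    ext s t
    rw [Matrix.sum_apply]
    by_cases hst : s = t
    · subst hst
      simp
    · simp [Matrix.diagonal_apply_ne _ hst]
  simp only [hamiltonian, pauliZ_eq, onSite_diagonal, Matrix.diagonal_mul_diagonal]
  rw [hsum, hsum, ← Matrix.diagonal_smul, ← Matrix.diagonal_smul, Matrix.diagonal_neg,
    Matrix.diagonal_sub]
  congr 1
  ext s
  simp [isingEnergy, magnetization, bondSum]

theorem gibbs_diagonal {N : ℕ} (T : ℝ) (E : (Fin N → Fin 2) → ℝ) :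
    gibbs T (Matrix.diagonal (fun s => (E s : ℂ)) : Op N)
      = Matrix.diagonal (fun s => (gibbsWeight E T⁻¹ s : ℂ)) := by
  rw [gibbs, ← Matrix.diagonal_smul, Matrix.exp_diagonal]
  have h : (NormedSpace.exp ((-((T⁻¹ : ℝ) : ℂ)) • fun s => (E s : ℂ)) : (Fin N → Fin 2) → ℂ)
      = fun s => (Real.exp (-T⁻¹ * E s) : ℂ) := by
    ext s
    rw [Pi.coe_exp, ← Complex.exp_eq_exp_ℂ]
    simp
  rw [h, Matrix.trace_diagonal, ← Matrix.diagonal_smul]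
  congr 1
  ext s
  simp only [gibbsWeight, partitionSum, Pi.smul_apply, smul_eq_mul]
  push_cast
  ring

theorem thermal_eq (N : ℕ) (J T h : ℝ) :
    thermal N J T h
      = Matrix.diagonal (fun s => (gibbsWeight (isingEnergy N J h) T⁻¹ s : ℂ)) := by
  rw [thermal, hamiltonian_eq, gibbs_diagonal]

theorem energy_thermal (N : ℕ) (J T h h' : ℝ) :
    energy (thermal N J T h) (hamiltonian N J h')
      = gibbsMean (isingEnergy N J h) T⁻¹ (isingEnergy N J h') := by
  rw [energy, thermal_eq, hamiltonian_eq, Matrix.diagonal_mul_diagonal, Matrix.trace_diagonal,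
    Complex.re_sum]
  exact Finset.sum_congr rfl fun s _ => by rw [← Complex.ofReal_mul, Complex.ofReal_re]

theorem entropy_thermal (N : ℕ) (J T h : ℝ) :
    entropy (thermal N J T h)
      = Real.log (partitionSum (isingEnergy N J h) T⁻¹)
        + T⁻¹ * gibbsMean (isingEnergy N J h) T⁻¹ (isingEnergy N J h) := by
  have key : entropy (thermal N J T h) = -gibbsMean (isingEnergy N J h) T⁻¹
      (fun s => -T⁻¹ * isingEnergy N J h s
        - Real.log (partitionSum (isingEnergy N J h) T⁻¹)) := by
    rw [entropy, thermal_eq, cfc_diagonal, Matrix.diagonal_mul_diagonal, Matrix.trace_diagonal,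
      Complex.re_sum]
    congr 1
    refine Finset.sum_congr rfl fun s _ => ?_
    rw [← Complex.ofReal_mul, Complex.ofReal_re, log_gibbsWeight]
  rw [key, gibbsMean_sub, gibbsMean_const_mul, gibbsMean_const]
  ring

theorem relEntropy_thermal (N : ℕ) (J T T' h h' : ℝ) :
    relEntropy (thermal N J T h) (thermal N J T' h')
      = Real.log (partitionSum (isingEnergy N J h') T'⁻¹)
        - Real.log (partitionSum (isingEnergy N J h) T⁻¹)
        - T⁻¹ * gibbsMean (isingEnergy N J h) T⁻¹ (isingEnergy N J h)
        + T'⁻¹ * gibbsMean (isingEnergy N J h) T⁻¹ (isingEnergy N J h') := by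
  have key : relEntropy (thermal N J T h) (thermal N J T' h')
      = gibbsMean (isingEnergy N J h) T⁻¹ (fun s =>
        (-T⁻¹ * isingEnergy N J h s - Real.log (partitionSum (isingEnergy N J h) T⁻¹))
        - (-T'⁻¹ * isingEnergy N J h' s - Real.log (partitionSum (isingEnergy N J h') T'⁻¹))) := by
    rw [relEntropy, thermal_eq, thermal_eq, cfc_diagonal, cfc_diagonal, Matrix.diagonal_sub,
      Matrix.diagonal_mul_diagonal, Matrix.trace_diagonal, Complex.re_sum]
    refine Finset.sum_congr rfl fun s _ => ?_
    rw [← Complex.ofReal_sub, ← Complex.ofReal_mul, Complex.ofReal_re, log_gibbsWeight,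
      log_gibbsWeight]
  rw [key, gibbsMean_sub, gibbsMean_sub, gibbsMean_sub, gibbsMean_const_mul, gibbsMean_const_mul,
    gibbsMean_const, gibbsMean_const]
  ring

/-! ### The cycle with many small steps -/

/-- The mean magnetization in the thermal state. -/
noncomputable def meanMagnetization (N : ℕ) (J T h : ℝ) : ℝ :=
  gibbsMean (isingEnergy N J h) T⁻¹ magnetization

theorem isingEnergy_sub (N : ℕ) (J h h' : ℝ) (s : Fin N → Fin 2) :
    isingEnergy N J h s - isingEnergy N J h' s = (h' - h) * magnetization s := by
  rw [isingEnergy, isingEnergy]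
  ring

theorem quenchWork_thermal (N : ℕ) (J T h h' : ℝ) :
    quenchWork N J (thermal N J T h) h h' = (h' - h) * meanMagnetization N J T h := by
  rw [quenchWork, energy_thermal, energy_thermal, ← gibbsMean_sub, meanMagnetization,
    ← gibbsMean_const_mul]
  simp only [isingEnergy_sub]

/-- The negative free energy `T log Z` lies above its tangents in the field. -/
theorem freeEnergy_tangent (N : ℕ) (J : ℝ) {T : ℝ} (hT : 0 < T) (h h' : ℝ) :
    (h' - h) * meanMagnetization N J T h
      ≤ T * Real.log (partitionSum (isingEnergy N J h') T⁻¹)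
        - T * Real.log (partitionSum (isingEnergy N J h) T⁻¹) := by
  have key := gibbs_inequality (isingEnergy N J h) (isingEnergy N J h') T⁻¹ T⁻¹
  have h1 : gibbsMean (isingEnergy N J h) T⁻¹
      (fun s => T⁻¹ * isingEnergy N J h s - T⁻¹ * isingEnergy N J h' s)
      = T⁻¹ * ((h' - h) * meanMagnetization N J T h) := by
    rw [meanMagnetization, ← gibbsMean_const_mul, ← gibbsMean_const_mul]
    simp only [← mul_sub, isingEnergy_sub]
  rw [h1] at key
  have := mul_le_mul_of_nonneg_left key hT.le
  rw [mul_add, ← mul_assoc, mul_inv_cancel₀ hT.ne', one_mul] at this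
  linarith

/-- The work along a path of many small steps tends to the free energy difference. By the
tangent inequality every step of length `δ` loses an amount between `0` and `δ` times the
increase of the magnetization, and these bounds telescope. -/
theorem tendsto_pathWork (N : ℕ) (J : ℝ) {T : ℝ} (hT : 0 < T) (a b : ℝ) :
    Tendsto (fun m : ℕ => pathWork N J T a b m) atTop
      (𝓝 (T * Real.log (partitionSum (isingEnergy N J b) T⁻¹)
        - T * Real.log (partitionSum (isingEnergy N J a) T⁻¹))) := by
  set F : ℝ → ℝ := fun h => T * Real.log (partitionSum (isingEnergy N J h) T⁻¹) with hF
  set M : ℝ → ℝ := meanMagnetization N J T with hM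
  have htan : ∀ h h', (h' - h) * M h ≤ F h' - F h := freeEnergy_tangent N J hT
  have hbound : ∀ m : ℕ, 0 < m →
      pathWork N J T a b m ≤ F b - F a ∧
      F b - F a - (b - a) / m * (M b - M a) ≤ pathWork N J T a b m := by
    intro m hm
    have hm' : (m : ℝ) ≠ 0 := by exact_mod_cast hm.ne'
    set g : ℕ → ℝ := pathField a b m with hg
    have hg0 : g 0 = a := by simp [hg, pathField]
    have hgm : g m = b := by simp [hg, pathField, div_self hm']
    have hstep : ∀ i, g (i + 1) - g i = (b - a) / m := by
      intro i
      simp only [hg, pathField]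
      push_cast
      field_simp
      ring
    have hW : pathWork N J T a b m = ∑ i ∈ Finset.range m, (b - a) / m * M (g i) := by
      refine Finset.sum_congr rfl fun i _ => ?_
      rw [quenchWork_thermal, ← hstep i]
    have hFsum : F b - F a = ∑ i ∈ Finset.range m, (F (g (i + 1)) - F (g i)) := by
      rw [Finset.sum_range_sub (fun i => F (g i)), hg0, hgm]
    have hMsum : M b - M a = ∑ i ∈ Finset.range m, (M (g (i + 1)) - M (g i)) := by
      rw [Finset.sum_range_sub (fun i => M (g i)), hg0, hgm]
    rw [hW]
    constructor
    · rw [hFsum]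
      refine Finset.sum_le_sum fun i _ => ?_
      rw [← hstep i]
      exact htan _ _
    · rw [hFsum, hMsum, Finset.mul_sum, ← Finset.sum_sub_distrib]
      refine Finset.sum_le_sum fun i _ => ?_
      have := htan (g (i + 1)) (g i)
      rw [← hstep i]
      linarith
  have hlim : Tendsto (fun m : ℕ => F b - F a - (b - a) / m * (M b - M a)) atTop
      (𝓝 (F b - F a)) := by
    have := ((tendsto_const_div_atTop_nhds_zero_nat (b - a)).mul_const (M b - M a)).const_sub
      (F b - F a)
    simpa using this
  refine tendsto_of_tendsto_of_tendsto_of_le_of_le' hlim tendsto_const_nhds ?_ ?_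
  · filter_upwards [eventually_gt_atTop 0] with m hm using (hbound m hm).2
  · filter_upwards [eventually_gt_atTop 0] with m hm using (hbound m hm).1

theorem pathHeat_eq (N : ℕ) (J T a b : ℝ) {m : ℕ} (hm : 0 < m) :
    pathHeat N J T a b m
      = energy (thermal N J T b) (hamiltonian N J b)
        - energy (thermal N J T a) (hamiltonian N J a) + pathWork N J T a b m := by
  have hm' : (m : ℝ) ≠ 0 := by exact_mod_cast hm.ne'
  set u : ℕ → ℝ := fun i => energy (thermal N J T (pathField a b m i))
    (hamiltonian N J (pathField a b m i)) with hu
  have h0 : u 0 = energy (thermal N J T a) (hamiltonian N J a) := by simp [hu, pathField]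
  have h1 : u m = energy (thermal N J T b) (hamiltonian N J b) := by
    simp [hu, pathField, div_self hm']
  rw [← h0, ← h1, ← Finset.sum_range_sub, pathWork, ← Finset.sum_add_distrib]
  refine Finset.sum_congr rfl fun i _ => ?_
  rw [contactHeat, quenchWork]
  ring

theorem tendsto_cycleWork (N : ℕ) (J : ℝ) {Tc Th : ℝ} (hTc : 0 < Tc) (hTh : 0 < Th)
    (hA hB hC hD : ℝ) :
    Tendsto (fun m : ℕ => cycleWork N J Tc Th hA hB hC hD m) atTop
      (𝓝 (work N J Tc Th hA hB hC hD)) := by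
  have h := (((tendsto_pathWork N J hTh hA hB).const_add
    (quenchWork N J (thermal N J Tc hD) hD hA)).add_const
    (quenchWork N J (thermal N J Th hB) hB hC)).add (tendsto_pathWork N J hTc hC hD)
  refine (congrArg (Tendsto _ _ <| 𝓝 ·) ?_).mp h
  rw [work, deltaS, penaltyDA, penaltyBC, entropy_thermal, entropy_thermal, relEntropy_thermal,
    relEntropy_thermal, quenchWork, quenchWork, energy_thermal, energy_thermal, energy_thermal,
    energy_thermal]
  field_simp
  ring

/-- The heat delivered by the hot bath tends to `Th (ΔS - D(ω_c^D‖ω_h^A))`. -/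
theorem tendsto_cycleHeat (N : ℕ) (J : ℝ) {Tc Th : ℝ} (hTc : 0 < Tc) (hTh : 0 < Th)
    (hA hB hD : ℝ) :
    Tendsto (fun m : ℕ => cycleHeat N J Tc Th hA hB hD m) atTop
      (𝓝 (Th * (deltaS N J Tc Th hB hD - penaltyDA N J Tc Th hD hA))) := by
  have h := ((tendsto_pathWork N J hTh hA hB).const_add
    (energy (thermal N J Th hB) (hamiltonian N J hB)
        - energy (thermal N J Th hA) (hamiltonian N J hA))).const_add
    (contactHeat N J Th (thermal N J Tc hD) hA)
  refine Tendsto.congr' (f₁ := fun m : ℕ => contactHeat N J Th (thermal N J Tc hD) hA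
    + (energy (thermal N J Th hB) (hamiltonian N J hB)
        - energy (thermal N J Th hA) (hamiltonian N J hA) + pathWork N J Th hA hB m)) ?_ ?_
  · filter_upwards [eventually_gt_atTop 0] with m hm
    rw [cycleHeat, pathHeat_eq N J Th hA hB hm]
  · refine (congrArg (Tendsto _ _ <| 𝓝 ·) ?_).mp h
    rw [deltaS, penaltyDA, entropy_thermal, entropy_thermal, relEntropy_thermal, contactHeat,
      energy_thermal, energy_thermal, energy_thermal]
    field_simp
    ring

theorem tendsto_cycle_efficiency (N : ℕ) (J : ℝ) {Tc Th : ℝ} (hTc : 0 < Tc) (hTh : 0 < Th)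
    (hA hB hC hD : ℝ) (hpos : 0 < deltaS N J Tc Th hB hD - penaltyDA N J Tc Th hD hA) :
    Tendsto (fun m : ℕ => cycleWork N J Tc Th hA hB hC hD m /
        |cycleHeat N J Tc Th hA hB hD m|) atTop
      (𝓝 (efficiency N J Tc Th hA hB hC hD)) := by
  have hQ : 0 < Th * (deltaS N J Tc Th hB hD - penaltyDA N J Tc Th hD hA) := mul_pos hTh hpos
  have h := (tendsto_cycleWork N J hTc hTh hA hB hC hD).div
    (tendsto_cycleHeat N J hTc hTh hA hB hD).abs (abs_pos.2 hQ.ne').ne'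
  refine (congrArg (Tendsto _ _ <| 𝓝 ·) ?_).mp h
  rw [abs_of_pos hQ, efficiency, work]
  have := hpos.ne'
  field_simp
  ring

/-! ### Ground states at the critical field -/

theorem sum_spin_rotate {N : ℕ} (s : Fin N → Fin 2) :
    ∑ j, spin (s (finRotate N j)) = ∑ j, spin (s j) :=
  Equiv.sum_comp (finRotate N) fun j => spin (s j)

/-- At the field `2 ε J` with `ε = ± 1` the energy counts, up to a constant, the bonds both of
whose spins equal `ε`. -/
theorem isingEnergy_critical (N : ℕ) (J ε : ℝ) (hε : ε ^ 2 = 1) (s : Fin N → Fin 2) :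
    isingEnergy N J (2 * ε * J) s
      = N * J - J * ∑ j, (1 + ε * spin (s j)) * (1 + ε * spin (s (finRotate N j))) := by
  have h : ∑ j, (1 + ε * spin (s j)) * (1 + ε * spin (s (finRotate N j)))
      = N + 2 * ε * magnetization s + bondSum s := by
    have h1 : ∀ j, (1 + ε * spin (s j)) * (1 + ε * spin (s (finRotate N j)))
        = 1 + ε * spin (s j) + ε * spin (s (finRotate N j))
          + spin (s j) * spin (s (finRotate N j)) := by
      intro j
      linear_combination (spin (s j) * spin (s (finRotate N j))) * hε
    simp only [h1, Finset.sum_add_distrib, ← Finset.mul_sum, sum_spin_rotate]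
    simp only [Finset.sum_const, Finset.card_univ, Fintype.card_fin, nsmul_eq_mul, mul_one,
      magnetization, bondSum]
    ring
  rw [h, isingEnergy]
  ring

theorem one_add_mul_spin_nonneg {ε : ℝ} (hε : ε = 1 ∨ ε = -1) (a : Fin 2) :
    0 ≤ 1 + ε * spin a := by
  rcases hε with rfl | rfl <;> rw [spin] <;> split_ifs <;> norm_num

theorem le_isingEnergy_critical (N : ℕ) {J ε : ℝ} (hJ : J < 0) (hε : ε = 1 ∨ ε = -1)
    (s : Fin N → Fin 2) : N * J ≤ isingEnergy N J (2 * ε * J) s := by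
  rw [isingEnergy_critical N J ε (by rcases hε with rfl | rfl <;> norm_num)]
  have : 0 ≤ ∑ j, (1 + ε * spin (s j)) * (1 + ε * spin (s (finRotate N j))) :=
    Finset.sum_nonneg fun j _ =>
      mul_nonneg (one_add_mul_spin_nonneg hε _) (one_add_mul_spin_nonneg hε _)
  nlinarith

/-- The configuration with value `d` on the sites `0, 2, 4, …` and prescribed values on the
sites `1, 3, 5, …`. -/
def alternating (N : ℕ) (d : Fin 2) (c : Fin (N / 2) → Fin 2) (j : Fin N) : Fin 2 :=
  if h : (j : ℕ) % 2 = 1 then c ⟨j / 2, by have := j.isLt; lia⟩ else d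

theorem alternating_injective (N : ℕ) (d : Fin 2) : Function.Injective (alternating N d) := by
  intro c c' h
  ext k
  have hk := k.isLt
  have h1 := congrFun h ⟨2 * k + 1, by lia⟩
  have h2 : (2 * (k : ℕ) + 1) % 2 = 1 := by lia
  have h3 : (⟨(2 * (k : ℕ) + 1) / 2, by lia⟩ : Fin (N / 2)) = k := Fin.ext (by simp; lia)
  simp only [alternating, h2, dif_pos, h3] at h1
  rw [h1]

theorem isingEnergy_alternating (N : ℕ) (J : ℝ) {ε : ℝ} (hε : ε ^ 2 = 1) {d : Fin 2}
    (hd : spin d = -ε) (c : Fin (N / 2) → Fin 2) :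
    isingEnergy N J (2 * ε * J) (alternating N d c) = N * J := by
  rw [isingEnergy_critical N J ε hε, Finset.sum_eq_zero, mul_zero, sub_zero]
  intro j _
  have heven : ∀ k : Fin N, (k : ℕ) % 2 ≠ 1 → 1 + ε * spin (alternating N d c k) = 0 := by
    intro k hk
    rw [alternating, dif_neg hk, hd]
    linear_combination -hε
  by_cases hj : (j : ℕ) % 2 = 1
  · rw [heven (finRotate N j), mul_zero]
    obtain ⟨n, rfl⟩ : ∃ n, N = n + 1 := ⟨N - 1, by have := j.isLt; lia⟩
    rw [coe_finRotate]
    split_ifs <;> lia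
  · rw [heven j hj, zero_mul]

/-- The dimension of an eigenspace of a diagonal Hamiltonian is at least the number of
configurations of that energy. -/
theorem card_le_degeneracy {N : ℕ} (E : (Fin N → Fin 2) → ℝ) (e : ℝ) {κ : Type*} [Fintype κ]
    (f : κ → Fin N → Fin 2) (hf : Function.Injective f) (hE : ∀ k, E (f k) = e) :
    Fintype.card κ ≤ degeneracy (Matrix.diagonal (fun s => (E s : ℂ)) : Op N) e := by
  have hmem : ∀ k, (Pi.single (f k) 1 : (Fin N → Fin 2) → ℂ) ∈ Module.End.eigenspace
      (Matrix.toLin' (Matrix.diagonal (fun s => (E s : ℂ)) : Op N)) (e : ℂ) := by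
    intro k
    rw [Module.End.mem_eigenspace_iff, Matrix.toLin'_apply]
    ext s
    rw [Matrix.mulVec_diagonal, Pi.smul_apply, smul_eq_mul]
    by_cases hs : s = f k
    · rw [hs, hE]
    · simp [Pi.single_eq_of_ne hs]
  have hli : LinearIndependent ℂ
      (fun k => (⟨Pi.single (f k) 1, hmem k⟩ : Module.End.eigenspace
        (Matrix.toLin' (Matrix.diagonal (fun s => (E s : ℂ)) : Op N)) (e : ℂ))) := by
    have h : LinearIndependent ℂ (fun k => (Pi.single (f k) 1 : (Fin N → Fin 2) → ℂ)) := by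
      simpa [Function.comp_def] using
        (Pi.basisFun ℂ (Fin N → Fin 2)).linearIndependent.comp f hf
    exact LinearIndependent.of_comp (Submodule.subtype _) h
  exact hli.fintype_card_le_finrank

theorem exists_groundEnergy_degenerate (N : ℕ) {J ε : ℝ} (hJ : J < 0) (hε : ε = 1 ∨ ε = -1) :
    ∃ E : ℝ, IsGroundEnergy (hamiltonian N J (2 * ε * J)) E ∧
      2 ^ (N / 2) ≤ degeneracy (hamiltonian N J (2 * ε * J)) E := by
  obtain ⟨d, hd⟩ : ∃ d, spin d = -ε := by
    rcases hε with rfl | rfl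
    · exact ⟨1, by simp [spin]⟩
    · exact ⟨0, by simp [spin]⟩
  have hε2 : ε ^ 2 = 1 := by rcases hε with rfl | rfl <;> norm_num
  refine ⟨N * J, ⟨?_, ?_⟩, ?_⟩
  · rw [Set.mem_ofPred_eq, hamiltonian_eq, hasEigenvalue_toLin'_diagonal_iff]
    exact ⟨alternating N d fun _ => d, by rw [isingEnergy_alternating N J hε2 hd]⟩
  · intro x hx
    rw [Set.mem_ofPred_eq, hamiltonian_eq, hasEigenvalue_toLin'_diagonal_iff] at hx
    obtain ⟨s, hs⟩ := hx
    rw [← Complex.ofReal_injective hs]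
    exact le_isingEnergy_critical N hJ hε s
  · have h := card_le_degeneracy (isingEnergy N J (2 * ε * J)) (N * J) (alternating N d)
      (alternating_injective N d) (isingEnergy_alternating N J hε2 hd)
    rw [hamiltonian_eq]
    simpa using h

/-! ### The transfer matrix -/

/-- Summing a product of matrix entries along open paths gives the entries of a matrix power. -/
theorem sum_path_eq_pow {α : Type*} [Fintype α] [DecidableEq α] (V : Matrix α α ℝ) (n : ℕ)
    (W : α → α → ℝ) :
    ∑ s : Fin (n + 1) → α, (∏ j : Fin n, V (s j.castSucc) (s j.succ)) * W (s 0) (s (Fin.last n))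
      = ∑ a, ∑ b, (V ^ n) a b * W a b := by
  induction n generalizing W with
  | zero =>
    rw [← (Equiv.funUnique (Fin 1) α).symm.sum_comp]
    simp [Matrix.one_apply]
  | succ n ih =>
    rw [← (Fin.consEquiv fun _ => α).sum_comp, Fintype.sum_prod_type]
    refine Finset.sum_congr rfl fun a _ => ?_
    have h := ih fun x y => V a x * W a y
    calc _ = ∑ t : Fin (n + 1) → α, (∏ j : Fin n, V (t j.castSucc) (t j.succ)) *
          (V a (t 0) * W a (t (Fin.last n))) := by
          refine Finset.sum_congr rfl fun t _ => ?_
          rw [Fin.prod_univ_succ]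
          simp only [Fin.consEquiv_apply, Fin.castSucc_zero, Fin.cons_zero, Fin.cons_succ,
            ← Fin.succ_castSucc, ← Fin.succ_last]
          ring
      _ = _ := by
          rw [h, Finset.sum_comm]
          refine Finset.sum_congr rfl fun y _ => ?_
          rw [pow_succ', Matrix.mul_apply, Finset.sum_mul]
          exact Finset.sum_congr rfl fun x _ => by ring

theorem sum_cycle_eq_trace {α : Type*} [Fintype α] [DecidableEq α] (V : Matrix α α ℝ) (n : ℕ) :
    ∑ s : Fin (n + 1) → α, ∏ j, V (s j) (s (finRotate (n + 1) j)) = (V ^ (n + 1)).trace := by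
  have h := sum_path_eq_pow V n fun a b => V b a
  have h1 : ∀ s : Fin (n + 1) → α, ∏ j, V (s j) (s (finRotate (n + 1) j))
      = (∏ j : Fin n, V (s j.castSucc) (s j.succ)) * V (s (Fin.last n)) (s 0) := by
    intro s
    rw [Fin.prod_univ_castSucc, finRotate_last]
    congr 1
    refine Finset.prod_congr rfl fun j _ => ?_
    rw [finRotate_apply, Fin.coeSucc_eq_succ]
  simp only [h1, h, pow_succ, Matrix.trace, Matrix.diag_apply, Matrix.mul_apply]

/-- A trace of powers of a two by two matrix with eigenvalues `p` and `q`. -/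
theorem trace_pow_fin_two (V : Matrix (Fin 2) (Fin 2) ℝ) {p q : ℝ} (htr : V.trace = p + q)
    (hdet : V.det = p * q) (n : ℕ) : (V ^ n).trace = p ^ n + q ^ n := by
  have hCH : V * V = (p + q) • V - (p * q) • (1 : Matrix (Fin 2) (Fin 2) ℝ) := by
    rw [← htr, ← hdet, Matrix.trace_fin_two, Matrix.det_fin_two]
    ext i j
    fin_cases i <;> fin_cases j <;>
      simp [Matrix.mul_apply, Fin.sum_univ_two] <;> ring
  induction n using Nat.twoStepInduction with
  | zero => simp; norm_num
  | one => simpa using htr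
  | more n h0 h1 =>
    have : V ^ (n + 2) = (p + q) • V ^ (n + 1) - (p * q) • V ^ n := by
      rw [pow_add, pow_two, hCH, mul_sub, Matrix.mul_smul, Matrix.mul_smul, mul_one, ← pow_succ]
    rw [this, Matrix.trace_sub, Matrix.trace_smul, Matrix.trace_smul, h0, h1, smul_eq_mul,
      smul_eq_mul]
    ring

/-- The symmetric transfer matrix of the Ising ring; every bond carries half of the field energy
of each of its two sites. -/
noncomputable def transferMatrix (J h β : ℝ) : Matrix (Fin 2) (Fin 2) ℝ := fun a b =>
  Real.exp (β * (h * ((spin a + spin b) / 2) + J * (spin a * spin b)))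

/-- Half the trace of the transfer matrix. -/
noncomputable def halfTrace (J h β : ℝ) : ℝ := Real.exp (β * J) * Real.cosh (β * h)

/-- Half the distance of the two eigenvalues of the transfer matrix. -/
noncomputable def halfGap (J h β : ℝ) : ℝ :=
  √(Real.exp (β * J) ^ 2 * Real.sinh (β * h) ^ 2 + Real.exp (-(β * J)) ^ 2)

/-- The larger eigenvalue of the transfer matrix. -/
noncomputable def eigMax (J h β : ℝ) : ℝ := halfTrace J h β + halfGap J h β

/-- The smaller eigenvalue of the transfer matrix. -/
noncomputable def eigMin (J h β : ℝ) : ℝ := halfTrace J h β - halfGap J h β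

theorem halfTrace_pos (J h β : ℝ) : 0 < halfTrace J h β :=
  mul_pos (Real.exp_pos _) (Real.cosh_pos _)

theorem halfGap_radicand_pos (J h β : ℝ) :
    0 < Real.exp (β * J) ^ 2 * Real.sinh (β * h) ^ 2 + Real.exp (-(β * J)) ^ 2 := by
  have := Real.exp_pos (-(β * J))
  positivity

theorem halfGap_pos (J h β : ℝ) : 0 < halfGap J h β := Real.sqrt_pos.2 (halfGap_radicand_pos J h β)

theorem eigMax_pos (J h β : ℝ) : 0 < eigMax J h β :=
  add_pos (halfTrace_pos J h β) (halfGap_pos J h β)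

theorem abs_eig_ratio_lt_one (J h β : ℝ) : |eigMin J h β / eigMax J h β| < 1 := by
  have h1 := halfTrace_pos J h β
  have h2 := halfGap_pos J h β
  rw [abs_div, abs_of_pos (eigMax_pos J h β), div_lt_one (eigMax_pos J h β), abs_lt, eigMin, eigMax]
  constructor <;> linarith

theorem differentiable_halfGap (J h : ℝ) : Differentiable ℝ (halfGap J h) := by
  intro β
  unfold halfGap
  refine DifferentiableAt.sqrt ?_ (halfGap_radicand_pos J h β).ne'
  fun_prop

theorem differentiable_halfTrace (J h : ℝ) : Differentiable ℝ (halfTrace J h) := by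
  unfold halfTrace
  fun_prop

theorem differentiable_eigMax (J h : ℝ) : Differentiable ℝ (eigMax J h) :=
  (differentiable_halfTrace J h).add (differentiable_halfGap J h)

theorem differentiable_eigMin (J h : ℝ) : Differentiable ℝ (eigMin J h) :=
  (differentiable_halfTrace J h).sub (differentiable_halfGap J h)

theorem trace_transferMatrix (J h β : ℝ) :
    (transferMatrix J h β).trace = eigMax J h β + eigMin J h β := by
  have h1 : β * (h * ((1 + 1) / 2) + J * (1 * 1)) = β * J + β * h := by ring
  have h2 : β * (h * ((-1 + -1) / 2) + J * (-1 * -1)) = β * J + -(β * h) := by ring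
  simp only [Matrix.trace_fin_two, transferMatrix, spin, if_true, one_ne_zero, if_false, eigMax,
    eigMin, halfTrace, Real.cosh_eq]
  rw [h1, h2, Real.exp_add, Real.exp_add]
  ring

theorem det_transferMatrix (J h β : ℝ) :
    (transferMatrix J h β).det = eigMax J h β * eigMin J h β := by
  have h1 : β * (h * ((1 + 1) / 2) + J * (1 * 1)) = β * J + β * h := by ring
  have h2 : β * (h * ((-1 + -1) / 2) + J * (-1 * -1)) = β * J + -(β * h) := by ring
  have h3 : β * (h * ((1 + -1) / 2) + J * (1 * -1)) = -(β * J) := by ring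
  have h4 : β * (h * ((-1 + 1) / 2) + J * (-1 * 1)) = -(β * J) := by ring
  have h5 : eigMax J h β * eigMin J h β = halfTrace J h β ^ 2 - halfGap J h β ^ 2 := by
    rw [eigMax, eigMin]
    ring
  rw [h5, halfGap, Real.sq_sqrt (halfGap_radicand_pos J h β).le, halfTrace, mul_pow, Real.cosh_sq]
  simp only [Matrix.det_fin_two, transferMatrix, spin, if_true, one_ne_zero, if_false]
  rw [h1, h2, h3, h4, Real.exp_add, Real.exp_add]
  have : Real.exp (β * h) * Real.exp (-(β * h)) = 1 := by rw [← Real.exp_add]; simp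
  linear_combination Real.exp (β * J) ^ 2 * this

theorem partitionSum_ising (n : ℕ) (J h β : ℝ) :
    partitionSum (isingEnergy (n + 1) J h) β
      = eigMax J h β ^ (n + 1) + eigMin J h β ^ (n + 1) := by
  rw [← trace_pow_fin_two _ (trace_transferMatrix J h β) (det_transferMatrix J h β),
    ← sum_cycle_eq_trace, partitionSum]
  refine Finset.sum_congr rfl fun s _ => ?_
  simp only [transferMatrix]
  rw [← Real.exp_sum]
  congr 1
  have hs := sum_spin_rotate s
  simp only [isingEnergy, magnetization, bondSum, ← Finset.mul_sum, Finset.sum_add_distrib,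
    ← Finset.sum_div, hs]
  ring

/-! ### Thermodynamic densities -/

/-- The thermodynamic limit of `log Z / N`. -/
noncomputable def pressure (J h β : ℝ) : ℝ := Real.log (eigMax J h β)

/-- The mean energy per site in the thermodynamic limit, `-∂ pressure / ∂β`. -/
noncomputable def energyDensity (J h β : ℝ) : ℝ := -(deriv (eigMax J h) β / eigMax J h β)

/-- The entropy per site in the thermodynamic limit. -/
noncomputable def entropyDensity (J h β : ℝ) : ℝ := pressure J h β + β * energyDensity J h β

/-- The relative entropy per site, in the thermodynamic limit, of the Gibbs states at inverse
temperatures `β` and `β'` and equal field. -/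
noncomputable def relEntropyDensity (J h β β' : ℝ) : ℝ :=
  pressure J h β' - pressure J h β - β * energyDensity J h β + β' * energyDensity J h β

theorem tendsto_eig_ratio_pow (J h β : ℝ) :
    Tendsto (fun n : ℕ => (eigMin J h β / eigMax J h β) ^ n) atTop (𝓝 0) :=
  tendsto_pow_atTop_nhds_zero_of_abs_lt_one (abs_eig_ratio_lt_one J h β)

theorem tendsto_log_partitionSum (J h β : ℝ) :
    Tendsto (fun N : ℕ => Real.log (partitionSum (isingEnergy N J h) β) / N) atTop
      (𝓝 (pressure J h β)) := by
  rw [← tendsto_add_atTop_iff_nat 1]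
  set r := eigMin J h β / eigMax J h β with hr
  have hpos := eigMax_pos J h β
  have hr0 : Tendsto (fun n : ℕ => r ^ (n + 1)) atTop (𝓝 0) :=
    (tendsto_add_atTop_iff_nat 1).2 (tendsto_eig_ratio_pow J h β)
  have hlog : Tendsto (fun n : ℕ => Real.log (1 + r ^ (n + 1))) atTop (𝓝 0) := by
    have h1 : Tendsto (fun n : ℕ => 1 + r ^ (n + 1)) atTop (𝓝 1) := by
      simpa using hr0.const_add 1
    simpa using h1.log one_ne_zero
  have hinv : Tendsto (fun n : ℕ => (((n + 1 : ℕ) : ℝ))⁻¹) atTop (𝓝 0) :=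
    (tendsto_add_atTop_iff_nat 1).2 tendsto_inv_atTop_nhds_zero_nat
  have hlim : Tendsto (fun n : ℕ => pressure J h β
      + Real.log (1 + r ^ (n + 1)) * (((n + 1 : ℕ) : ℝ))⁻¹) atTop (𝓝 (pressure J h β)) := by
    simpa using (hlog.mul hinv).const_add (pressure J h β)
  refine hlim.congr fun n => ?_
  have hlt : 0 < 1 + r ^ (n + 1) := by
    have h1 : |r ^ (n + 1)| < 1 := by
      rw [abs_pow]
      exact pow_lt_one₀ (abs_nonneg _) (abs_eig_ratio_lt_one J h β) (Nat.succ_ne_zero n)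
    linarith [(abs_lt.1 h1).1]
  have hn : ((n + 1 : ℕ) : ℝ) ≠ 0 := by positivity
  have hZ : eigMax J h β ^ (n + 1) + eigMin J h β ^ (n + 1)
      = eigMax J h β ^ (n + 1) * (1 + r ^ (n + 1)) := by
    rw [mul_add, mul_one, ← mul_pow, hr, mul_div_cancel₀ _ hpos.ne']
  rw [partitionSum_ising, hZ, Real.log_mul (pow_pos hpos _).ne' hlt.ne', Real.log_pow, pressure]
  field_simp

theorem tendsto_mean_energy (J h β : ℝ) :
    Tendsto (fun N : ℕ => gibbsMean (isingEnergy N J h) β (isingEnergy N J h) / N) atTop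
      (𝓝 (energyDensity J h β)) := by
  rw [← tendsto_add_atTop_iff_nat 1]
  set r := eigMin J h β / eigMax J h β with hr
  have hpos := eigMax_pos J h β
  have hr0 : Tendsto (fun n : ℕ => r ^ n) atTop (𝓝 0) := tendsto_eig_ratio_pow J h β
  have hr1 : Tendsto (fun n : ℕ => r ^ (n + 1)) atTop (𝓝 0) := (tendsto_add_atTop_iff_nat 1).2 hr0
  have hlim : Tendsto (fun n : ℕ =>
      -((deriv (eigMax J h) β + r ^ n * deriv (eigMin J h) β) /
        (eigMax J h β * (1 + r ^ (n + 1))))) atTop (𝓝 (energyDensity J h β)) := by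
    have h1 := (hr0.mul_const (deriv (eigMin J h) β)).const_add (deriv (eigMax J h) β)
    have h2 := (hr1.const_add 1).const_mul (eigMax J h β)
    have h3 := (h1.div h2 (by simpa using hpos.ne')).neg
    simpa [energyDensity] using h3
  refine hlim.congr fun n => ?_
  have hd : HasDerivAt (partitionSum (isingEnergy (n + 1) J h))
      (((n + 1 : ℕ) : ℝ) * eigMax J h β ^ n * deriv (eigMax J h) β
        + ((n + 1 : ℕ) : ℝ) * eigMin J h β ^ n * deriv (eigMin J h) β) β := by
    have h1 := ((differentiable_eigMax J h β).hasDerivAt.pow (n + 1)).add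
      ((differentiable_eigMin J h β).hasDerivAt.pow (n + 1))
    refine h1.congr_of_eventuallyEq (Eventually.of_forall fun b => ?_)
    rw [partitionSum_ising]
    rfl
  have hn : ((n + 1 : ℕ) : ℝ) ≠ 0 := by positivity
  have hmin : eigMin J h β = eigMax J h β * r := by rw [hr, mul_div_cancel₀ _ hpos.ne']
  rw [gibbsMean_energy _ _ hd, partitionSum_ising, hmin, neg_div, div_div]
  congr 1
  have e1 : ((n + 1 : ℕ) : ℝ) * eigMax J h β ^ n * deriv (eigMax J h) β
      + ((n + 1 : ℕ) : ℝ) * (eigMax J h β * r) ^ n * deriv (eigMin J h) β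
      = (((n + 1 : ℕ) : ℝ) * eigMax J h β ^ n)
        * (deriv (eigMax J h) β + r ^ n * deriv (eigMin J h) β) := by
    rw [mul_pow]
    ring
  have e2 : (eigMax J h β ^ (n + 1) + (eigMax J h β * r) ^ (n + 1)) * ((n + 1 : ℕ) : ℝ)
      = (((n + 1 : ℕ) : ℝ) * eigMax J h β ^ n) * (eigMax J h β * (1 + r ^ (n + 1))) := by
    rw [mul_pow, pow_succ (eigMax J h β)]
    ring
  rw [e1, e2, mul_div_mul_left _ _ (mul_ne_zero hn (pow_pos hpos n).ne')]

/-- The pressure lies above its tangents in the inverse temperature, as the limit of the finite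
volume Gibbs inequality. -/
theorem pressure_tangent (J h β β' : ℝ) :
    pressure J h β + (β - β') * energyDensity J h β ≤ pressure J h β' := by
  refine le_of_tendsto_of_tendsto' ((tendsto_log_partitionSum J h β).add
    ((tendsto_mean_energy J h β).const_mul (β - β'))) (tendsto_log_partitionSum J h β')
    fun N => ?_
  have key := gibbs_inequality (isingEnergy N J h) (isingEnergy N J h) β β'
  simp only [← sub_mul, gibbsMean_const_mul] at key
  rw [← mul_div_assoc, ← add_div]
  exact div_le_div_of_nonneg_right key (Nat.cast_nonneg N)

theorem tendsto_entropy_thermal (J T h : ℝ) :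
    Tendsto (fun N : ℕ => entropy (thermal N J T h) / N) atTop
      (𝓝 (entropyDensity J h T⁻¹)) := by
  refine ((tendsto_log_partitionSum J h T⁻¹).add
    ((tendsto_mean_energy J h T⁻¹).const_mul T⁻¹)).congr fun N => ?_
  rw [entropy_thermal]
  ring

theorem tendsto_relEntropy_thermal (J T T' h : ℝ) :
    Tendsto (fun N : ℕ => relEntropy (thermal N J T h) (thermal N J T' h) / N) atTop
      (𝓝 (relEntropyDensity J h T⁻¹ T'⁻¹)) := by
  refine ((((tendsto_log_partitionSum J h T'⁻¹).sub (tendsto_log_partitionSum J h T⁻¹)).sub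
    ((tendsto_mean_energy J h T⁻¹).const_mul T⁻¹)).add
    ((tendsto_mean_energy J h T⁻¹).const_mul T'⁻¹)).congr fun N => ?_
  rw [relEntropy_thermal]
  ring

/-! ### Asymptotics of the densities -/

/-- If the pressure at every positive inverse temperature is `β c + K + o(1)`, with `-c` a ground
state energy per site, then the excess energy vanishes. The tangents of the pressure at `β`,
evaluated at `2 β` and at `β / 2`, bound it from both sides. -/
theorem tendsto_energyDensity_add {α : Type*} {l : Filter α} {J h c : α → ℝ} {K : ℝ}
    (hp : ∀ β, 0 < β → Tendsto (fun a => pressure (J a) (h a) β - β * c a) l (𝓝 K))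
    {β : ℝ} (hβ : 0 < β) :
    Tendsto (fun a => energyDensity (J a) (h a) β + c a) l (𝓝 0) := by
  have h0 := hp β hβ
  have h1 := ((h0.sub (hp (2 * β) (by positivity))).div_const β)
  have h2 := (((hp (β / 2) (by positivity)).sub h0).div_const (β / 2))
  simp only [sub_self, zero_div] at h1 h2
  refine tendsto_of_tendsto_of_tendsto_of_le_of_le h1 h2 (fun a => ?_) (fun a => ?_)
  · rw [div_le_iff₀ hβ]
    linarith [pressure_tangent (J a) (h a) β (2 * β)]
  · rw [le_div_iff₀ (by positivity)]
    linarith [pressure_tangent (J a) (h a) β (β / 2)]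

theorem tendsto_entropyDensity {α : Type*} {l : Filter α} {J h c : α → ℝ} {K : ℝ}
    (hp : ∀ β, 0 < β → Tendsto (fun a => pressure (J a) (h a) β - β * c a) l (𝓝 K))
    {β : ℝ} (hβ : 0 < β) :
    Tendsto (fun a => entropyDensity (J a) (h a) β) l (𝓝 K) := by
  have h1 := (hp β hβ).add ((tendsto_energyDensity_add hp hβ).const_mul β)
  rw [mul_zero, add_zero] at h1
  refine h1.congr fun a => ?_
  rw [entropyDensity]
  ring

theorem tendsto_relEntropyDensity {α : Type*} {l : Filter α} {J h c : α → ℝ} {K : ℝ}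
    (hp : ∀ β, 0 < β → Tendsto (fun a => pressure (J a) (h a) β - β * c a) l (𝓝 K))
    {β β' : ℝ} (hβ : 0 < β) (hβ' : 0 < β') :
    Tendsto (fun a => relEntropyDensity (J a) (h a) β β') l (𝓝 0) := by
  have h1 := ((hp β' hβ').sub (hp β hβ)).add
    ((tendsto_energyDensity_add hp hβ).const_mul (β' - β))
  rw [mul_zero, add_zero, sub_self] at h1
  refine h1.congr fun a => ?_
  rw [relEntropyDensity]
  ring

theorem eigMax_mul_exp (J h β c : ℝ) :
    eigMax J h β * Real.exp (-(β * c))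
      = (Real.exp (β * (J + h - c)) + Real.exp (β * (J - h - c))) / 2
        + √(((Real.exp (β * (J + h - c)) - Real.exp (β * (J - h - c))) / 2) ^ 2
          + Real.exp (β * (-J - c)) ^ 2) := by
  have h1 : Real.exp (β * (J + h - c))
      = Real.exp (β * J) * Real.exp (β * h) * Real.exp (-(β * c)) := by
    rw [← Real.exp_add, ← Real.exp_add]
    ring_nf
  have h2 : Real.exp (β * (J - h - c))
      = Real.exp (β * J) * Real.exp (-(β * h)) * Real.exp (-(β * c)) := by
    rw [← Real.exp_add, ← Real.exp_add]
    ring_nf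
  have h3 : Real.exp (β * (-J - c)) = Real.exp (-(β * J)) * Real.exp (-(β * c)) := by
    rw [← Real.exp_add]
    ring_nf
  rw [eigMax, add_mul, halfTrace, halfGap, Real.cosh_eq, Real.sinh_eq]
  congr 1
  · rw [h1, h2]
    ring
  · rw [← Real.sqrt_sq (Real.exp_pos (-(β * c))).le, ← Real.sqrt_mul' _ (sq_nonneg _),
      h1, h2, h3]
    congr 1
    ring

theorem pressure_sub (J h β c : ℝ) :
    pressure J h β - β * c = Real.log (eigMax J h β * Real.exp (-(β * c))) := by
  rw [Real.log_mul (eigMax_pos J h β).ne' (Real.exp_ne_zero _), Real.log_exp, pressure]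
  ring

/-- In a strong field the pressure is that of the fully polarized configuration alone. -/
theorem tendsto_pressure_strong_field {α : Type*} {l : Filter α} {J h : α → ℝ}
    (hh : Tendsto h l atTop) (hJ : Tendsto (fun a => h a + 2 * J a) l atTop) (β : ℝ)
    (hβ : 0 < β) :
    Tendsto (fun a => pressure (J a) (h a) β - β * (J a + h a)) l (𝓝 0) := by
  have h1 : Tendsto (fun a => Real.exp (β * (J a - h a - (J a + h a)))) l (𝓝 0) := by
    refine Real.tendsto_exp_atBot.comp ?_
    refine (hh.const_mul_atTop_of_neg (r := -2 * β) (by linarith)).congr fun a => ?_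
    ring
  have h2 : Tendsto (fun a => Real.exp (β * (-J a - (J a + h a)))) l (𝓝 0) := by
    refine Real.tendsto_exp_atBot.comp ?_
    refine (hJ.const_mul_atTop_of_neg (r := -β) (by linarith)).congr fun a => ?_
    ring
  have h3 : Tendsto (fun a => eigMax (J a) (h a) β * Real.exp (-(β * (J a + h a)))) l (𝓝 1) := by
    have h4 := ((h1.const_add 1).div_const 2).add
      (((((h1.const_sub 1).div_const 2).pow 2).add (h2.pow 2)).sqrt)
    have e : (1 + 0) / 2 + √(((1 - 0) / 2) ^ 2 + (0 : ℝ) ^ 2) = 1 := by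
      have : ((1 - 0) / 2) ^ 2 + (0 : ℝ) ^ 2 = (1 / 2) ^ 2 := by norm_num
      rw [this, Real.sqrt_sq (by norm_num)]
      norm_num
    rw [e] at h4
    refine h4.congr fun a => ?_
    rw [eigMax_mul_exp, sub_self (J a + h a), mul_zero, Real.exp_zero]
  have h5 := h3.log one_ne_zero
  rw [Real.log_one] at h5
  exact h5.congr fun a => (pressure_sub _ _ _ _).symm

theorem eigMax_critical (J β ε : ℝ) (hε : ε = 1 ∨ ε = -1) :
    eigMax J (2 * ε * J) β * Real.exp (-(β * -J))
      = (1 + Real.exp (4 * β * J)) / 2 + √(((1 - Real.exp (4 * β * J)) / 2) ^ 2 + 1) := by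
  rw [eigMax_mul_exp]
  rcases hε with rfl | rfl
  · rw [show β * (J + 2 * 1 * J - -J) = 4 * β * J by ring,
      show β * (J - 2 * 1 * J - -J) = 0 by ring, show β * (-J - -J) = 0 by ring, Real.exp_zero]
    ring_nf
  · rw [show β * (J + 2 * -1 * J - -J) = 0 by ring,
      show β * (J - 2 * -1 * J - -J) = 4 * β * J by ring, show β * (-J - -J) = 0 by ring,
      Real.exp_zero]
    ring_nf

/-- At the critical field the ground states are the configurations without two adjacent spins
against the field, and their number grows like a power of the golden ratio. -/
theorem tendsto_pressure_critical {ε : ℝ} (hε : ε = 1 ∨ ε = -1) (β : ℝ) (hβ : 0 < β) :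
    Tendsto (fun J => pressure J (2 * ε * J) β - β * -J) atBot
      (𝓝 (Real.log Real.goldenRatio)) := by
  have h1 : Tendsto (fun J => Real.exp (4 * β * J)) atBot (𝓝 0) :=
    Real.tendsto_exp_atBot.comp (tendsto_id.const_mul_atBot (by positivity))
  have h2 := ((h1.const_add 1).div_const 2).add
    (((((h1.const_sub 1).div_const 2).pow 2).add_const 1).sqrt)
  have e : (1 + 0) / 2 + √(((1 - 0) / 2) ^ 2 + (1 : ℝ)) = Real.goldenRatio := by
    have : ((1 - 0) / 2) ^ 2 + (1 : ℝ) = 5 / 2 ^ 2 := by norm_num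
    rw [this, Real.sqrt_div (by norm_num), Real.sqrt_sq (by norm_num), Real.goldenRatio]
    ring
  rw [e] at h2
  refine (h2.log Real.goldenRatio_pos.ne').congr fun J => ?_
  rw [pressure_sub, eigMax_critical J β ε hε]

theorem entropyDensity_critical_pos {J ε : ℝ} (hJ : J < 0) (hε : ε = 1 ∨ ε = -1) {β : ℝ}
    (hβ : 0 < β) : 0 < entropyDensity J (2 * ε * J) β := by
  have h1 : J ≤ energyDensity J (2 * ε * J) β := by
    refine ge_of_tendsto (tendsto_mean_energy J (2 * ε * J) β) ?_
    filter_upwards [eventually_gt_atTop 0] with N hN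
    rw [le_div_iff₀ (by exact_mod_cast hN), mul_comm]
    exact le_gibbsMean _ _ (le_isingEnergy_critical N hJ hε)
  have h2 : 0 < pressure J (2 * ε * J) β - β * -J := by
    rw [pressure_sub, eigMax_critical J β ε hε]
    refine Real.log_pos ?_
    have h3 := Real.exp_pos (4 * β * J)
    have h4 : 1 ≤ √(((1 - Real.exp (4 * β * J)) / 2) ^ 2 + 1) :=
      Real.one_le_sqrt.2 (by nlinarith [sq_nonneg ((1 - Real.exp (4 * β * J)) / 2)])
    linarith
  rw [entropyDensity]
  nlinarith

theorem half_log_two_le_log_goldenRatio : 1 / 2 * Real.log 2 ≤ Real.log Real.goldenRatio := by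
  have h1 : Real.log 2 ≤ Real.log (Real.goldenRatio ^ 2) := by
    refine Real.log_le_log two_pos ?_
    rw [Real.goldenRatio_sq]
    linarith [Real.one_lt_goldenRatio]
  rw [Real.log_pow] at h1
  push_cast at h1
  linarith

/-! ### Work and efficiency in the thermodynamic limit -/

/-- The work per site in the thermodynamic limit, with `hA = hD = x` and `hB = hC = y`. -/
noncomputable def workDensity (Tc Th J x y : ℝ) : ℝ :=
  (Th - Tc) * (entropyDensity J y Th⁻¹ - entropyDensity J x Tc⁻¹)
    - (Th * relEntropyDensity J x Tc⁻¹ Th⁻¹ + Tc * relEntropyDensity J y Th⁻¹ Tc⁻¹)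

/-- The heat from the hot bath per site in the thermodynamic limit, divided by its
temperature. -/
noncomputable def heatDensity (Tc Th J x y : ℝ) : ℝ :=
  entropyDensity J y Th⁻¹ - entropyDensity J x Tc⁻¹ - relEntropyDensity J x Tc⁻¹ Th⁻¹

/-- The efficiency in the thermodynamic limit, with `hA = hD = x` and `hB = hC = y`. -/
noncomputable def efficiencyLimit (Tc Th J x y : ℝ) : ℝ :=
  1 - Tc / Th * ((entropyDensity J y Th⁻¹ - entropyDensity J x Tc⁻¹
    + relEntropyDensity J y Th⁻¹ Tc⁻¹) / heatDensity Tc Th J x y)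

theorem tendsto_work_div (Tc Th J x y : ℝ) :
    Tendsto (fun N : ℕ => work N J Tc Th x y y x / (N : ℝ)) atTop
      (𝓝 (workDensity Tc Th J x y)) := by
  refine ((((tendsto_entropy_thermal J Th y).sub (tendsto_entropy_thermal J Tc x)).const_mul
    (Th - Tc)).sub (((tendsto_relEntropy_thermal J Tc Th x).const_mul Th).add
    ((tendsto_relEntropy_thermal J Th Tc y).const_mul Tc))).congr fun N => ?_
  rw [work, deltaS, penaltyDA, penaltyBC]
  ring

theorem tendsto_heat_div (Tc Th J x y : ℝ) :
    Tendsto (fun N : ℕ => (deltaS N J Tc Th y x - penaltyDA N J Tc Th x x) / (N : ℝ)) atTop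
      (𝓝 (heatDensity Tc Th J x y)) := by
  refine (((tendsto_entropy_thermal J Th y).sub (tendsto_entropy_thermal J Tc x)).sub
    (tendsto_relEntropy_thermal J Tc Th x)).congr fun N => ?_
  rw [deltaS, penaltyDA]
  ring

theorem eventually_heat_pos {Tc Th J x y : ℝ} (h : 0 < heatDensity Tc Th J x y) :
    ∀ᶠ N : ℕ in atTop, 0 < deltaS N J Tc Th y x - penaltyDA N J Tc Th x x := by
  filter_upwards [(tendsto_heat_div Tc Th J x y).eventually_const_lt h, eventually_gt_atTop 0]
    with N hN hN0
  exact (div_pos_iff_of_pos_right (by exact_mod_cast hN0)).1 hN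

theorem tendsto_efficiency {Tc Th J x y : ℝ} (h : 0 < heatDensity Tc Th J x y) :
    Tendsto (fun N : ℕ => efficiency N J Tc Th x y y x) atTop
      (𝓝 (efficiencyLimit Tc Th J x y)) := by
  have hnum : Tendsto (fun N : ℕ => (deltaS N J Tc Th y x + penaltyBC N J Tc Th y y) / (N : ℝ))
      atTop (𝓝 (entropyDensity J y Th⁻¹ - entropyDensity J x Tc⁻¹
        + relEntropyDensity J y Th⁻¹ Tc⁻¹)) := by
    refine (((tendsto_entropy_thermal J Th y).sub (tendsto_entropy_thermal J Tc x)).add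
      (tendsto_relEntropy_thermal J Th Tc y)).congr fun N => ?_
    rw [deltaS, penaltyBC]
    ring
  refine Tendsto.congr' ?_ (((hnum.div (tendsto_heat_div Tc Th J x y) h.ne').const_mul
    (Tc / Th)).const_sub 1)
  filter_upwards [eventually_gt_atTop 0] with N hN
  have hN' : (N : ℝ) ≠ 0 := by exact_mod_cast hN.ne'
  rw [efficiency, Pi.div_apply, div_div_div_cancel_right₀ hN']

/-- Limits of the work, heat and efficiency along `(J, x, y)` when the field `x` freezes the
spins, in terms of the limits of the densities at the field `y`. -/
theorem tendsto_densities {Tc Th : ℝ} (hTc : 0 < Tc) (hTh : 0 < Th) {α : Type*} {l : Filter α}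
    {J x y : α → ℝ} {S D : ℝ} (hx : Tendsto x l atTop)
    (hJ : Tendsto (fun a => x a + 2 * J a) l atTop)
    (hS : Tendsto (fun a => entropyDensity (J a) (y a) Th⁻¹) l (𝓝 S))
    (hD : Tendsto (fun a => relEntropyDensity (J a) (y a) Th⁻¹ Tc⁻¹) l (𝓝 D)) :
    Tendsto (fun a => workDensity Tc Th (J a) (x a) (y a)) l (𝓝 ((Th - Tc) * S - Tc * D)) ∧
    Tendsto (fun a => heatDensity Tc Th (J a) (x a) (y a)) l (𝓝 S) ∧
    (S ≠ 0 → Tendsto (fun a => efficiencyLimit Tc Th (J a) (x a) (y a)) l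
      (𝓝 (1 - Tc / Th * ((S + D) / S)))) := by
  have hp := tendsto_pressure_strong_field hx hJ
  have hS0 := tendsto_entropyDensity hp (inv_pos.2 hTc)
  have hD0 := tendsto_relEntropyDensity hp (inv_pos.2 hTc) (inv_pos.2 hTh)
  have hdiff := hS.sub hS0
  have hheat := hdiff.sub hD0
  have hwork := (hdiff.const_mul (Th - Tc)).sub ((hD0.const_mul Th).add (hD.const_mul Tc))
  simp only [sub_zero, mul_zero, zero_add] at hdiff hheat hwork
  exact ⟨hwork, hheat, fun hne => (((hdiff.add hD).div hheat hne).const_mul (Tc / Th)).const_sub 1⟩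

end IsingEngine

open IsingEngine

theorem mainTheorem2 (Tc Th κ : ℝ) (hTc : 0 < Tc) (hTh : Tc < Th) (hκ : κ = 2 ∨ κ = -2) :
    -- `work` and `efficiency` are those of the cycle, for paths with many small steps
    (∀ (N : ℕ) (J hA hB hC hD : ℝ),
      Tendsto (fun m : ℕ => IsingEngine.cycleWork N J Tc Th hA hB hC hD m) atTop
        (𝓝 (IsingEngine.work N J Tc Th hA hB hC hD)) ∧
      (0 < IsingEngine.deltaS N J Tc Th hB hD - IsingEngine.penaltyDA N J Tc Th hD hA →
        Tendsto (fun m : ℕ => IsingEngine.cycleWork N J Tc Th hA hB hC hD m /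
            |IsingEngine.cycleHeat N J Tc Th hA hB hD m|) atTop
          (𝓝 (IsingEngine.efficiency N J Tc Th hA hB hC hD)))) ∧
    -- exponential ground-state degeneracy at `|h| = 2|J|`
    (∀ J : ℝ, J < 0 → ∀ N : ℕ, ∃ E : ℝ,
      IsingEngine.IsGroundEnergy (IsingEngine.hamiltonian N J (κ * J)) E ∧
      2 ^ (N / 2) ≤ IsingEngine.degeneracy (IsingEngine.hamiltonian N J (κ * J)) E) ∧
    ∃ (w η : ℝ → ℝ → ℝ) (wInf ηInf s : ℝ → ℝ) (wLim sLim : ℝ),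
      -- thermodynamic limit, at coupling `J` and fields `hA = hD = x`, `hB = hC = κ J`
      (∀ J : ℝ, J < 0 → ∀ x : ℝ,
        Tendsto (fun N : ℕ => IsingEngine.work N J Tc Th x (κ * J) (κ * J) x / (N : ℝ)) atTop
          (𝓝 (w J x))) ∧
      (∀ J : ℝ, J < 0 → ∀ᶠ x in atTop,
        (∀ᶠ N : ℕ in atTop,
          0 < IsingEngine.deltaS N J Tc Th (κ * J) x - IsingEngine.penaltyDA N J Tc Th x x) ∧
        Tendsto (fun N : ℕ => IsingEngine.efficiency N J Tc Th x (κ * J) (κ * J) x) atTop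
          (𝓝 (η J x))) ∧
      (∀ J : ℝ, J < 0 →
        Tendsto (fun N : ℕ =>
            IsingEngine.entropy (IsingEngine.thermal N J Th (κ * J)) / (N : ℝ)) atTop
          (𝓝 (s J))) ∧
      -- then `x → ∞`, and then `J → -∞`
      (∀ J : ℝ, J < 0 → Tendsto (w J) atTop (𝓝 (wInf J)) ∧ Tendsto (η J) atTop (𝓝 (ηInf J))) ∧
      Tendsto ηInf atBot (𝓝 (1 - Tc / Th)) ∧
      Tendsto wInf atBot (𝓝 wLim) ∧
      Tendsto s atBot (𝓝 sLim) ∧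
      wLim = (Th - Tc) * sLim ∧
      (Th - Tc) * (1 / 2 * Real.log 2) ≤ wLim ∧
      -- the same for fields that grow with `J` such that `x J / |J| → ∞`
      (∀ x : ℝ → ℝ, Tendsto (fun J => x J / |J|) atBot atTop →
        (∀ᶠ J in atBot,
          (∀ᶠ N : ℕ in atTop, 0 < IsingEngine.deltaS N J Tc Th (κ * J) (x J)
            - IsingEngine.penaltyDA N J Tc Th (x J) (x J)) ∧
          Tendsto (fun N : ℕ => IsingEngine.efficiency N J Tc Th (x J) (κ * J) (κ * J) (x J)) atTop
            (𝓝 (η J (x J)))) ∧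
        Tendsto (fun J => η J (x J)) atBot (𝓝 (1 - Tc / Th)) ∧
        Tendsto (fun J => w J (x J)) atBot (𝓝 wLim)) := by
  have hTh0 : 0 < Th := hTc.trans hTh
  obtain ⟨ε, hε, rfl⟩ : ∃ ε : ℝ, (ε = 1 ∨ ε = -1) ∧ κ = 2 * ε := by
    rcases hκ with rfl | rfl
    · exact ⟨1, Or.inl rfl, by norm_num⟩
    · exact ⟨-1, Or.inr rfl, by norm_num⟩
  have hSpos : ∀ J : ℝ, J < 0 → 0 < entropyDensity J (2 * ε * J) Th⁻¹ := fun J hJ =>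
    entropyDensity_critical_pos hJ hε (inv_pos.2 hTh0)
  have hfield : ∀ J : ℝ, Tendsto (fun x : ℝ => x + 2 * J) atTop atTop := fun J =>
    tendsto_atTop_add_const_right _ _ tendsto_id
  have hstrong := fun J : ℝ => tendsto_densities hTc hTh0 (J := fun _ : ℝ => J)
    (y := fun _ => 2 * ε * J) tendsto_id (hfield J) tendsto_const_nhds tendsto_const_nhds
  have hp := tendsto_pressure_critical hε
  have hS := tendsto_entropyDensity hp (inv_pos.2 hTh0)
  have hD := tendsto_relEntropyDensity hp (inv_pos.2 hTh0) (inv_pos.2 hTc)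
  have hφ : 0 < Real.log Real.goldenRatio := Real.log_pos Real.one_lt_goldenRatio
  refine ⟨fun N J hA hB hC hD => ⟨tendsto_cycleWork N J hTc hTh0 hA hB hC hD,
      tendsto_cycle_efficiency N J hTc hTh0 hA hB hC hD⟩,
    fun J hJ N => exists_groundEnergy_degenerate N hJ hε,
    fun J x => workDensity Tc Th J x (2 * ε * J), fun J x => efficiencyLimit Tc Th J x (2 * ε * J),
    fun J => (Th - Tc) * entropyDensity J (2 * ε * J) Th⁻¹
      - Tc * relEntropyDensity J (2 * ε * J) Th⁻¹ Tc⁻¹,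
    fun J => 1 - Tc / Th * ((entropyDensity J (2 * ε * J) Th⁻¹
      + relEntropyDensity J (2 * ε * J) Th⁻¹ Tc⁻¹) / entropyDensity J (2 * ε * J) Th⁻¹),
    fun J => entropyDensity J (2 * ε * J) Th⁻¹, (Th - Tc) * Real.log Real.goldenRatio,
    Real.log Real.goldenRatio, fun J _ x => tendsto_work_div Tc Th J x _, fun J hJ => ?_,
    fun J _ => tendsto_entropy_thermal J Th _,
    fun J hJ => ⟨(hstrong J).1, (hstrong J).2.2 (hSpos J hJ).ne'⟩, ?_, ?_, hS, rfl,
    mul_le_mul_of_nonneg_left half_log_two_le_log_goldenRatio (sub_nonneg.2 hTh.le),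
    fun x hx => ?_⟩
  · filter_upwards [(hstrong J).2.1.eventually_const_lt (hSpos J hJ)] with x hx
    exact ⟨eventually_heat_pos hx, tendsto_efficiency hx⟩
  · simpa [div_self hφ.ne'] using
      (((hS.add hD).div hS hφ.ne').const_mul (Tc / Th)).const_sub 1
  · simpa using (hS.const_mul (Th - Tc)).sub (hD.const_mul Tc)
  · have habs : Tendsto (fun J : ℝ => |J|) atBot atTop := tendsto_abs_atBot_atTop
    have hx1 : Tendsto x atBot atTop := by
      refine (habs.atTop_mul_atTop₀ hx).congr' ?_
      filter_upwards [eventually_lt_atBot 0] with J hJ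
      exact mul_div_cancel₀ _ (abs_pos.2 hJ.ne).ne'
    have hx2 : Tendsto (fun J => x J + 2 * J) atBot atTop := by
      refine (habs.atTop_mul_atTop₀ (tendsto_atTop_add_const_right _ (-2) hx)).congr' ?_
      filter_upwards [eventually_lt_atBot 0] with J hJ
      rw [mul_add, mul_div_cancel₀ _ (abs_pos.2 hJ.ne).ne', abs_of_neg hJ]
      ring
    obtain ⟨hw, hq, hη⟩ := tendsto_densities hTc hTh0 hx1 hx2 hS hD
    refine ⟨?_, ?_, ?_⟩
    · filter_upwards [hq.eventually_const_lt hφ] with J hJ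
      exact ⟨eventually_heat_pos hJ, tendsto_efficiency hJ⟩
    · simpa [div_self hφ.ne'] using hη hφ.ne'
    · simpa using hw
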